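/- Let $H$ be a separable infinite-dimensional complex Hilbert space and let $K(H)$ be the algebra of compact operators on $H$. For a positive $a\in K(H)$ let $\lambda_1(a)\ge\lambda_2(a)\ge\cdots$ be the sequence of its nonzero eigenvalues in decreasing order, counted with multiplicity, with zeros appended if $a$ has finite rank. Let $\alpha:\{0,1,2,\dots\}\to[0,\infty)$ be a monotone increasing (not necessarily strictly) function with $\alpha(0)=0$ and $\alpha(1)>0$, put $c_i:=\alpha(i)-\alpha(i-1)$ for $i=1,2,\dots$, and define the non-linear trace of Choquet type $$\varphi_\alpha(a):=\sum_{i=1}^{\infty}\bigl(\lambda_i(a)-\lambda_{i+1}(a)\bigr)\,\alpha(i)\in[0,\infty]\qquad (a\in K(H),\ a\ge 0).$$ Fix a real number $p\ge 1$ and set $|||a|||_{\alpha,p}:=\varphi_\alpha(|a|^p)^{1/p}\in[0,\infty]$ for $a\in K(H)$, where $|a|=(a^*a)^{1/2}$ and $\infty^{1/p}=\infty$. Then the following conditions are equivalent: 1. $\alpha$ is concave, in the sense that $\dfrac{\alpha(i+1)+\alpha(i-1)}{2}\le\alpha(i)$ for all $i=1,2,3,\dots$; 2. $(c_i)_i$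 is a decreasing sequence: $c_1\ge c_2\ge\cdots\ge c_n\ge\cdots$; 3. $|||\cdot|||_{\alpha,p}$ satisfies the triangle inequality, the value $+\infty$ being allowed: $|||a+b|||_{\alpha,p}\le|||a|||_{\alpha,p}+|||b|||_{\alpha,p}$ for all $a,b\in K(H)$. -/

import Mathlib

open scoped ENNReal

/-- `s` lists the eigenvalues of the positive compact operator `a` on an infinite dimensional
Hilbert space in decreasing order, repeated according to multiplicity and padded with zeros if `a`
has finite rank: `s` decreases to `0`, and `a = ∑ n, s n • p n` where `p n` is the rank one
projection onto the line spanned by the `n`-th vector of an orthonormal sequence.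
(Indexing starts at `0`: `s n` is the `(n + 1)`-st eigenvalue. If some `s n` vanishes, then so do all
the later ones and `a` has finite rank, so if `a` has infinite rank then no `s n` is zero. The
vectors orthogonal to the sequence lie in the kernel of `a`, so every nonzero eigenvalue is listed
as often as its multiplicity, and `a` determines `s`.) -/
structure IsEigenvalueSequence {H : Type*} [NormedAddCommGroup H] [InnerProductSpace ℂ H]
    (a : H →L[ℂ] H) (s : ℕ → ℝ) : Prop where
  antitone : Antitone s
  tendsto_zero : Filter.Tendsto s Filter.atTop (nhds 0)
  decomposition : ∃ e : ℕ → H, Orthonormal ℂ e ∧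
    ∀ x : H, HasSum (fun n => (s n : ℂ) • (inner ℂ (e n) x • e n)) (a x)

open Classical in
/-- The eigenvalue sequence `λ(a)` of a positive compact operator `a` on an infinite dimensional
Hilbert space, indexed from `0` (and `0` for operators which have no eigenvalue sequence). -/
noncomputable def eigenvalueSequence {H : Type*} [NormedAddCommGroup H] [InnerProductSpace ℂ H]
    (a : H →L[ℂ] H) : ℕ → ℝ :=
  if h : ∃ s, IsEigenvalueSequence a s then h.choose else 0

/-- The non-linear trace of Choquet type associated with `α`,
`φ_α(a) = ∑_{i ≥ 1} (λ_i(a) - λ_{i+1}(a)) α(i)`, with values in `[0, ∞]`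
(the index `i` below is one less, since `eigenvalueSequence` starts at `0`). -/
noncomputable def choquetTrace {H : Type*} [NormedAddCommGroup H] [InnerProductSpace ℂ H]
    (α : ℕ → ℝ) (a : H →L[ℂ] H) : ℝ≥0∞ :=
  ∑' i : ℕ, ENNReal.ofReal
    ((eigenvalueSequence a i - eigenvalueSequence a (i + 1)) * α (i + 1))

/-- `|||a|||_{α,p} = φ_α(|a|^p)^{1/p}`, with values in `[0, ∞]`; the operators `|a| = (a* a)^{1/2}`
and `|a|^p` are given by the continuous functional calculus. -/
noncomputable def choquetSchattenNorm {H : Type*} [NormedAddCommGroup H] [InnerProductSpace ℂ H]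
    [CompleteSpace H] (α : ℕ → ℝ) (p : ℝ) (a : H →L[ℂ] H) : ℝ≥0∞ :=
  choquetTrace α ((CFC.abs a) ^ p) ^ (1 / p)

/-!
Put `c k = α (k + 1) - α k`. Summation by parts turns `|||a|||_{α,p}` into the weighted `ℓ^p` norm
`(∑ c k * s k ^ p)^(1/p)` of the singular values `s` of `a`.

If `c` decreases, the triangle inequality follows from Ky Fan's inequality, by which the singular
values of `a + b` are weakly majorized by the sum of those of `a` and of `b`: since `x ↦ x ^ p` is
convex, weak majorization bounds the norm with decreasing weights, and Minkowski's inequality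
concludes. Ky Fan's inequality itself holds because the sum of the `n` largest singular values of
`a` is the maximum of `|∑ ⟪e k, U (a (e k))⟫|` over orthonormal families `e` of size `n` and
contractions `U`, which is subadditive in `a`.

Conversely, test the triangle inequality on `a = diag (1, …, 1, 1, r)` with `m + 1` ones and on the
operator `b` obtained from `a` by exchanging the last two entries, so that
`a + b = diag (2, …, 2, 1 + r, 1 + r)`. It says
`(c m + c (m + 1)) * ((1 + r) / 2) ^ p ≤ c m + c (m + 1) * r ^ p` for `r ∈ [0, 1]`, with equality at
`r = 1`, and comparing derivatives there gives `c (m + 1) ≤ c m`.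
-/

section Majorization

variable {R : Type*} [CommRing R] [LinearOrder R] [IsStrictOrderedRing R]

theorem sum_range_mul_le_mul_sum_range_of_antitone {s d : ℕ → R} {C : R} {n N : ℕ}
    (hs : Antitone s) (hsn : 0 ≤ s n) (hd : ∀ k, 0 ≤ d k) (hdC : ∀ k, d k ≤ C) (hnN : n ≤ N)
    (hsum : ∑ k ∈ Finset.range N, d k ≤ n * C) :
    ∑ k ∈ Finset.range N, s k * d k ≤ C * ∑ k ∈ Finset.range n, s k := by
  have head : ∑ k ∈ Finset.range n, (s k - s n) * d k ≤ ∑ k ∈ Finset.range n, (s k - s n) * C :=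
    Finset.sum_le_sum fun k hk => mul_le_mul_of_nonneg_left (hdC k)
      (sub_nonneg.2 (hs (Finset.mem_range.1 hk).le))
  have tail : ∑ k ∈ Finset.Ico n N, (s k - s n) * d k ≤ 0 :=
    Finset.sum_nonpos fun k hk => mul_nonpos_of_nonpos_of_nonneg
      (sub_nonpos.2 (hs (Finset.mem_Ico.1 hk).1)) (hd k)
  have shifted : ∑ k ∈ Finset.range N, (s k - s n) * d k ≤
      ∑ k ∈ Finset.range n, (s k - s n) * C := by
    rw [← Finset.sum_range_add_sum_Ico _ hnN]
    linarith
  simp only [sub_mul, Finset.sum_sub_distrib, ← Finset.mul_sum, ← Finset.sum_mul, Finset.sum_const,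
    Finset.card_range, nsmul_eq_mul] at shifted
  linarith [mul_le_mul_of_nonneg_left hsum hsn]

theorem sum_range_mul_nonneg_of_antitone {w z : ℕ → R} {n : ℕ} (hw : Antitone w)
    (hw0 : ∀ k, 0 ≤ w k) (hz : ∀ m ≤ n, 0 ≤ ∑ k ∈ Finset.range m, z k) :
    0 ≤ ∑ k ∈ Finset.range n, w k * z k := by
  have byParts := Finset.sum_range_by_parts w z n
  simp only [smul_eq_mul] at byParts
  rw [byParts, sub_nonneg]
  refine (Finset.sum_nonpos fun i hi => ?_).trans (mul_nonneg (hw0 _) (hz n le_rfl))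
  have : i < n - 1 := Finset.mem_range.1 hi
  exact mul_nonpos_of_nonpos_of_nonneg (sub_nonpos.2 (hw i.le_succ)) (hz _ (by omega))

end Majorization

section WeightedLpNorm

theorem rpow_add_mul_sub_le_rpow {p x y : ℝ} (hp : 1 ≤ p) (hx : 0 ≤ x) (hy : 0 ≤ y) :
    x ^ p + p * x ^ (p - 1) * (y - x) ≤ y ^ p := by
  rcases hx.eq_or_lt with rfl | hx
  · rcases hp.eq_or_lt with rfl | hp
    · simp
    · rw [Real.zero_rpow (by linarith), Real.zero_rpow (by linarith)]
      simpa using Real.rpow_nonneg hy p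
  · have bernoulli : 1 + p * (y / x - 1) ≤ (y / x) ^ p := by
      simpa using one_add_mul_self_le_rpow_one_add (s := y / x - 1)
        (by linarith [div_nonneg hy hx.le]) hp
    calc x ^ p + p * x ^ (p - 1) * (y - x) = (1 + p * (y / x - 1)) * x ^ p := by
          rw [Real.rpow_sub_one hx.ne']
          field_simp
      _ ≤ (y / x) ^ p * x ^ p := mul_le_mul_of_nonneg_right bernoulli (Real.rpow_nonneg hx.le p)
      _ = y ^ p := by
          rw [← Real.mul_rpow (div_nonneg hy hx.le) hx.le, div_mul_cancel₀ _ hx.ne']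

theorem sum_range_mul_rpow_le_of_antitone {p : ℝ} {c x y : ℕ → ℝ} {n : ℕ} (hp : 1 ≤ p)
    (hc : Antitone c) (hc0 : ∀ k, 0 ≤ c k) (hx : Antitone x) (hx0 : ∀ k, 0 ≤ x k)
    (hy0 : ∀ k, 0 ≤ y k)
    (hxy : ∀ m ≤ n, ∑ k ∈ Finset.range m, x k ≤ ∑ k ∈ Finset.range m, y k) :
    ∑ k ∈ Finset.range n, c k * x k ^ p ≤ ∑ k ∈ Finset.range n, c k * y k ^ p := by
  have weight_nonneg (k : ℕ) : 0 ≤ c k * x k ^ (p - 1) :=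
    mul_nonneg (hc0 k) (Real.rpow_nonneg (hx0 k) _)
  have weight_antitone : Antitone fun k => c k * x k ^ (p - 1) := fun i j hij =>
    mul_le_mul (hc hij) (Real.rpow_le_rpow (hx0 j) (hx hij) (by linarith))
      (Real.rpow_nonneg (hx0 j) _) (hc0 i)
  have linear_nonneg : 0 ≤ ∑ k ∈ Finset.range n, c k * x k ^ (p - 1) * (y k - x k) :=
    sum_range_mul_nonneg_of_antitone weight_antitone weight_nonneg fun m hm => by
      simpa using hxy m hm
  calc ∑ k ∈ Finset.range n, c k * x k ^ p
      ≤ ∑ k ∈ Finset.range n, c k * x k ^ p +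
          p * ∑ k ∈ Finset.range n, c k * x k ^ (p - 1) * (y k - x k) :=
        le_add_of_nonneg_right (mul_nonneg (by linarith) linear_nonneg)
    _ = ∑ k ∈ Finset.range n, c k * (x k ^ p + p * x k ^ (p - 1) * (y k - x k)) := by
        rw [Finset.mul_sum, ← Finset.sum_add_distrib]
        exact Finset.sum_congr rfl fun k _ => by ring
    _ ≤ ∑ k ∈ Finset.range n, c k * y k ^ p := Finset.sum_le_sum fun k _ =>
        mul_le_mul_of_nonneg_left (rpow_add_mul_sub_le_rpow hp (hx0 k) (hy0 k)) (hc0 k)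

/-- The `ℓ^p` norm of `s` with respect to the measure of weights `c` on `ι`. -/
noncomputable def weightedLpNorm {ι : Type*} (c : ι → ℝ≥0∞) (p : ℝ) (s : ι → ℝ≥0∞) : ℝ≥0∞ :=
  (∑' k, c k * s k ^ p) ^ (1 / p)

theorem weightedLpNorm_add_le {ι : Type*} (c : ι → ℝ≥0∞) {p : ℝ} (hp : 1 ≤ p)
    (s t : ι → ℝ≥0∞) :
    weightedLpNorm c p (s + t) ≤ weightedLpNorm c p s + weightedLpNorm c p t := by
  let _ : MeasurableSpace ι := ⊤
  have lintegral_eq (f : ι → ℝ≥0∞) :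
      ∫⁻ k, f k ∂(MeasureTheory.Measure.sum fun k => c k • MeasureTheory.Measure.dirac k) =
        ∑' k, c k * f k := by
    simp only [MeasureTheory.lintegral_sum_measure, MeasureTheory.lintegral_smul_measure,
      MeasureTheory.lintegral_dirac, smul_eq_mul]
  simpa only [weightedLpNorm, lintegral_eq, Pi.add_apply] using
    ENNReal.lintegral_Lp_add_le (μ := .sum fun k => c k • .dirac k)
      (measurable_from_top (f := s)).aemeasurable (measurable_from_top (f := t)).aemeasurable hp

theorem weightedLpNorm_le_of_sum_range_le {p : ℝ} {c x y : ℕ → ℝ} (hp : 1 ≤ p) (hc : Antitone c)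
    (hc0 : ∀ k, 0 ≤ c k) (hx : Antitone x) (hx0 : ∀ k, 0 ≤ x k) (hy0 : ∀ k, 0 ≤ y k)
    (hxy : ∀ n, ∑ k ∈ Finset.range n, x k ≤ ∑ k ∈ Finset.range n, y k) :
    weightedLpNorm (fun k => .ofReal (c k)) p (fun k => .ofReal (x k)) ≤
      weightedLpNorm (fun k => .ofReal (c k)) p (fun k => .ofReal (y k)) := by
  have hp0 : 0 ≤ p := by linarith
  have sum_eq {s : ℕ → ℝ} (hs : ∀ k, 0 ≤ s k) (n : ℕ) :
      ∑ k ∈ Finset.range n, ENNReal.ofReal (c k) * ENNReal.ofReal (s k) ^ p =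
        ENNReal.ofReal (∑ k ∈ Finset.range n, c k * s k ^ p) := by
    simp only [ENNReal.ofReal_rpow_of_nonneg (hs _) hp0, ← ENNReal.ofReal_mul (hc0 _)]
    exact (ENNReal.ofReal_sum_of_nonneg fun k _ =>
      mul_nonneg (hc0 k) (Real.rpow_nonneg (hs k) p)).symm
  refine ENNReal.rpow_le_rpow ?_ (by positivity)
  simp only [ENNReal.tsum_eq_iSup_nat, sum_eq hx0, sum_eq hy0]
  exact iSup_mono fun n => ENNReal.ofReal_le_ofReal
    (sum_range_mul_rpow_le_of_antitone hp hc hc0 hx hx0 hy0 fun m _ => hxy m)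

theorem ofReal_eq_tsum_ofReal_sub {s : ℕ → ℝ} (hs : Antitone s)
    (hs0 : Filter.Tendsto s Filter.atTop (nhds 0)) (k : ℕ) :
    ENNReal.ofReal (s k) = ∑' i, ENNReal.ofReal (s (k + i) - s (k + i + 1)) := by
  have increment_nonneg (i : ℕ) : 0 ≤ s (k + i) - s (k + i + 1) := sub_nonneg.2 (hs (Nat.le_succ _))
  have telescope : HasSum (fun i => s (k + i) - s (k + i + 1)) (s k) := by
    rw [hasSum_iff_tendsto_nat_of_nonneg increment_nonneg]
    simp only [fun n => Finset.sum_range_sub' (fun i => s (k + i)) n, add_assoc, add_zero]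
    have tail : Filter.Tendsto (fun n => s (k + n)) Filter.atTop (nhds 0) := by
      simpa only [add_comm k] using (Filter.tendsto_add_atTop_iff_nat k).2 hs0
    simpa using tail.const_sub (s k)
  rw [← telescope.tsum_eq, ENNReal.ofReal_tsum_of_nonneg increment_nonneg telescope.summable]

theorem tsum_ofReal_sub_mul_eq {α s : ℕ → ℝ} (hα : Monotone α) (hα0 : α 0 = 0) (hs : Antitone s)
    (hs0 : Filter.Tendsto s Filter.atTop (nhds 0)) :
    ∑' i, ENNReal.ofReal ((s i - s (i + 1)) * α (i + 1)) =
      ∑' k, ENNReal.ofReal (α (k + 1) - α k) * ENNReal.ofReal (s k) := by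
  have hα_eq (i : ℕ) : ENNReal.ofReal (α (i + 1)) =
      ∑ k ∈ Finset.range (i + 1), ENNReal.ofReal (α (k + 1) - α k) := by
    rw [← ENNReal.ofReal_sum_of_nonneg fun k _ => sub_nonneg.2 (hα k.le_succ),
      Finset.sum_range_sub, hα0, sub_zero]
  calc ∑' i, ENNReal.ofReal ((s i - s (i + 1)) * α (i + 1))
      = ∑' i, ∑ kj ∈ Finset.HasAntidiagonal.antidiagonal i,
          ENNReal.ofReal (α (kj.1 + 1) - α kj.1) *
            ENNReal.ofReal (s (kj.1 + kj.2) - s (kj.1 + kj.2 + 1)) := by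
        refine tsum_congr fun i => ?_
        rw [ENNReal.ofReal_mul (sub_nonneg.2 (hs i.le_succ)), hα_eq, mul_comm, Finset.sum_mul,
          Finset.Nat.sum_antidiagonal_eq_sum_range_succ_mk]
        refine Finset.sum_congr rfl fun k hk => ?_
        rw [Nat.add_sub_cancel' (Finset.mem_range_succ_iff.1 hk)]
    _ = ∑' k, ∑' j, ENNReal.ofReal (α (k + 1) - α k) *
          ENNReal.ofReal (s (k + j) - s (k + j + 1)) := by
        rw [← ENNReal.tsum_prod, ← Finset.HasAntidiagonal.sigmaAntidiagonalEquivProd.tsum_eq,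
          ENNReal.tsum_sigma']
        exact tsum_congr fun i => (Finset.tsum_subtype' _ _).symm
    _ = ∑' k, ENNReal.ofReal (α (k + 1) - α k) * ENNReal.ofReal (s k) := by
        simp only [ENNReal.tsum_mul_left, ← ofReal_eq_tsum_ofReal_sub hs hs0]

end WeightedLpNorm

section HilbertSpace

variable {𝕜 E F ι : Type*} [RCLike 𝕜] [NormedAddCommGroup E] [InnerProductSpace 𝕜 E]

theorem sum_norm_inner_mul_norm_inner_le {e : ι → E} (he : Orthonormal 𝕜 e) (x y : E)
    (s : Finset ι) : ∑ i ∈ s, ‖inner 𝕜 (e i) x‖ * ‖inner 𝕜 (e i) y‖ ≤ ‖x‖ * ‖y‖ :=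
  (Real.sum_mul_le_sqrt_mul_sqrt s _ _).trans <| mul_le_mul
    ((Real.sqrt_le_left (norm_nonneg x)).2 (he.sum_inner_products_le x))
    ((Real.sqrt_le_left (norm_nonneg y)).2 (he.sum_inner_products_le y))
    (Real.sqrt_nonneg _) (norm_nonneg x)

theorem hasSum_inner_smul_apply [CompleteSpace E] [NormedAddCommGroup F] [NormedSpace 𝕜 F]
    {e : ι → E} (he : Orthonormal 𝕜 e) {T : E →L[𝕜] F}
    (hT : ∀ x, (∀ i, inner 𝕜 (e i) x = 0) → T x = 0) (x : E) :
    HasSum (fun i => inner 𝕜 (e i) x • T (e i)) (T x) := by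
  obtain ⟨y, hy⟩ : Summable fun i => inner 𝕜 (e i) x • e i := by
    simpa using (he.orthogonalFamily.summable_iff_norm_sq_summable fun i => inner 𝕜 (e i) x).2
      (he.inner_products_summable x)
  have inner_eq (i : ι) : inner 𝕜 (e i) y = inner 𝕜 (e i) x := by
    have inner_hasSum := hy.mapL (innerSL 𝕜 (e i))
    simp only [innerSL_apply_apply, inner_smul_right] at inner_hasSum
    rw [inner_hasSum.unique (hasSum_single i fun j hj => by rw [he.2 hj.symm, mul_zero]),
      inner_self_eq_norm_sq_to_K, he.1 i]
    simp
  have T_eq : T x = T y := by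
    rw [← sub_eq_zero, ← map_sub]
    exact hT _ fun i => by rw [inner_sub_right, inner_eq, sub_self]
  simpa only [T_eq, map_smul] using hy.mapL T

theorem tendsto_apply_cofinite_of_orthonormal [CompleteSpace E] [NormedAddCommGroup F]
    [InnerProductSpace 𝕜 F] [CompleteSpace F] {T : E →L[𝕜] F} (hT : IsCompactOperator T)
    {e : ι → E} (he : Orthonormal 𝕜 e) :
    Filter.Tendsto (fun i => T (e i)) Filter.cofinite (nhds 0) := by
  obtain ⟨K, hK, hTK⟩ := IsCompactOperator.image_closedBall_subset_compact hT 1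
  refine hK.tendsto_nhds_of_unique_mapClusterPt
    (.of_forall fun i => hTK ⟨e i, by simp [he.1], rfl⟩) fun z _ hz => ?_
  have inner_tendsto : Filter.Tendsto (fun i => inner 𝕜 (T (e i)) z) Filter.cofinite (nhds 0) := by
    simp only [← ContinuousLinearMap.adjoint_inner_right]
    rw [tendsto_zero_iff_norm_tendsto_zero]
    simpa using
      (he.inner_products_summable (ContinuousLinearMap.adjoint T z)).tendsto_cofinite_zero.sqrt
  have inner_cluster : ClusterPt (inner 𝕜 z z) (nhds (0 : 𝕜)) :=
    (hz.continuousAt_comp (f := fun w => inner 𝕜 w z) (by fun_prop)).clusterPt.mono inner_tendsto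
  exact inner_self_eq_zero.1 (eq_of_nhds_neBot inner_cluster)

theorem exists_comp_eq_of_norm_apply_le {G : Type*} [CompleteSpace E] [NormedAddCommGroup F]
    [NormedSpace 𝕜 F] [CompleteSpace F] [SeminormedAddCommGroup G] [NormedSpace 𝕜 G]
    {a : G →L[𝕜] F} {b : G →L[𝕜] E} {C : ℝ} (hC : 0 ≤ C) (hab : ∀ x, ‖a x‖ ≤ C * ‖b x‖) :
    ∃ U : E →L[𝕜] F, ‖U‖ ≤ C ∧ U ∘L b = a := by
  let K := b.range.topologicalClosure
  let b' : G →ₗ[𝕜] K := b.toLinearMap.codRestrict K fun x =>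
    b.range.le_topologicalClosure ⟨x, rfl⟩
  have b'_dense : DenseRange b' := by
    have : DenseRange (Set.inclusion b.range.le_topologicalClosure) :=
      (denseRange_inclusion_iff _).2 subset_rfl
    exact this.comp (Set.rangeFactorization_surjective (f := b)).denseRange (by fun_prop)
  let P := K.orthogonalProjectionOnto
  refine ⟨a.toLinearMap.extendOfNorm b' ∘L P, ?_, ?_⟩
  · calc _ ≤ ‖a.toLinearMap.extendOfNorm b'‖ * ‖P‖ := ContinuousLinearMap.opNorm_comp_le _ _
      _ ≤ C * 1 := mul_le_mul (LinearMap.opNorm_extendOfNorm_le b'_dense hC hab)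
          K.orthogonalProjectionOnto_norm_le (norm_nonneg _) hC
      _ = C := mul_one C
  · ext x
    have : P (b x) = b' x := K.orthogonalProjectionOnto_mem_subspace_eq_self (b' x)
    simp only [ContinuousLinearMap.comp_apply, this]
    exact LinearMap.extendOfNorm_eq b'_dense ⟨C, hab⟩ x

end HilbertSpace

section CompactPositiveOperators

variable {H : Type*} [NormedAddCommGroup H] [InnerProductSpace ℂ H] [CompleteSpace H]
  {T : H →L[ℂ] H}

theorem exists_unit_eigenvector_opNorm [Nontrivial H] (hT : 0 ≤ T) (hc : IsCompactOperator T) :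
    ∃ x, ‖x‖ = 1 ∧ T x = (‖T‖ : ℂ) • x := by
  rcases eq_or_ne T 0 with rfl | hT0
  · obtain ⟨x, hx⟩ := exists_norm_eq H zero_le_one
    exact ⟨x, hx, by simp⟩
  · have norm_mem : (‖T‖ : ℂ) ∈ spectrum ℂ T :=
      (spectrum.algebraMap_mem_iff ℂ).2 (CStarAlgebra.norm_mem_spectrum_of_nonneg hT)
    have norm_ne_zero : (‖T‖ : ℂ) ≠ 0 := by simpa using hT0
    obtain ⟨x, hx⟩ :=
      ((hc.hasEigenvalue_iff_mem_spectrum norm_ne_zero).2 norm_mem).exists_hasEigenvector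
    refine ⟨((‖x‖⁻¹ : ℝ) : ℂ) • x, ?_, ?_⟩
    · simp [norm_smul, hx.2]
    · rw [map_smul, smul_comm]
      exact congrArg _ hx.apply_eq_smul

theorem exists_max_eigenvector_orthogonal (hH : ¬ FiniteDimensional ℂ H) (hT : 0 ≤ T)
    (hc : IsCompactOperator T) (K : Submodule ℂ H)
    [FiniteDimensional ℂ K] (hK : K ∈ Module.End.invtSubmodule T.toLinearMap) :
    ∃ x ∈ Kᗮ, ∃ r : ℝ, ‖x‖ = 1 ∧ 0 ≤ r ∧ T x = (r : ℂ) • x ∧ ∀ y ∈ Kᗮ, ‖T y‖ ≤ r * ‖y‖ := by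
  have hpos := (ContinuousLinearMap.nonneg_iff_isPositive T).1 hT
  have maps_orthogonal : ∀ y ∈ Kᗮ, T y ∈ Kᗮ :=
    ContinuousLinearMap.orthogonal_mem_invtSubmodule (by rwa [hpos.isSelfAdjoint.adjoint_eq])
  have : Nontrivial Kᗮ := by
    rw [Submodule.nontrivial_iff_ne_bot, Ne, Submodule.orthogonal_eq_bot_iff]
    rintro rfl
    exact hH (Module.Finite.equiv Submodule.topEquiv)
  let S : Kᗮ →L[ℂ] Kᗮ := T.restrict maps_orthogonal
  have hS : 0 ≤ S := (ContinuousLinearMap.nonneg_iff_isPositive S).2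
    ⟨hpos.isSymmetric.restrict_invariant maps_orthogonal, fun y => hpos.2 y⟩
  obtain ⟨x, hx, hSx⟩ := exists_unit_eigenvector_opNorm hS (hc.restrict' maps_orthogonal)
  exact ⟨x, x.2, ‖S‖, hx, norm_nonneg S, congrArg Subtype.val hSx,
    fun y hy => S.le_opNorm ⟨y, hy⟩⟩

theorem exists_orthonormal_greedy_eigenvectors (hH : ¬ FiniteDimensional ℂ H) (hT : 0 ≤ T)
    (hc : IsCompactOperator T) :
    ∃ (e : ℕ → H) (s : ℕ → ℝ), Orthonormal ℂ e ∧ (∀ n, 0 ≤ s n) ∧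
      (∀ n, T (e n) = (s n : ℂ) • e n) ∧
      ∀ n y, (∀ m < n, inner ℂ (e m) y = 0) → ‖T y‖ ≤ s n * ‖y‖ := by
  let InvariantSubspace :=
    {K : Submodule ℂ H // FiniteDimensional ℂ K ∧ K ∈ Module.End.invtSubmodule T.toLinearMap}
  have next (K : InvariantSubspace) :=
    let _ := K.2.1
    exists_max_eigenvector_orthogonal hH hT hc K.1 K.2.2
  choose v v_orthogonal r norm_v r_nonneg T_v T_le using next
  have span_invariant (K : InvariantSubspace) :
      Submodule.span ℂ {v K} ∈ Module.End.invtSubmodule T.toLinearMap := by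
    rw [Module.End.mem_invtSubmodule, Submodule.span_singleton_le_iff_mem, Submodule.mem_comap,
      ContinuousLinearMap.coe_coe, T_v]
    exact Submodule.smul_mem _ _ (Submodule.mem_span_singleton_self _)
  let extend (K : InvariantSubspace) : InvariantSubspace :=
    have := K.2.1
    ⟨K.1 ⊔ Submodule.span ℂ {v K}, inferInstance,
      Module.End.invtSubmodule.sup_mem K.2.2 (span_invariant K)⟩
  let K (n : ℕ) : InvariantSubspace :=
    extend^[n] ⟨⊥, inferInstance, Module.End.invtSubmodule.bot_mem _⟩
  have K_succ (n : ℕ) : (K (n + 1)).1 = (K n).1 ⊔ Submodule.span ℂ {v (K n)} := by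
    simp only [K, Function.iterate_succ_apply', extend]
  have K_mono : Monotone fun n => (K n).1 := monotone_nat_of_le_succ fun n => by
    simp only [K_succ, le_sup_left]
  have mem_K {m n : ℕ} (hmn : m < n) : v (K m) ∈ (K n).1 := K_mono (Nat.succ_le_of_lt hmn) <| by
    simp only [K_succ]
    exact Submodule.mem_sup_right (Submodule.mem_span_singleton_self _)
  have inner_eq_zero {m n : ℕ} (hmn : m < n) : inner ℂ (v (K m)) (v (K n)) = 0 :=
    v_orthogonal (K n) _ (mem_K hmn)
  have mem_K_orthogonal {y : H} (n : ℕ) (hy : ∀ m < n, inner ℂ (v (K m)) y = 0) :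
      y ∈ (K n).1ᗮ := by
    induction n with
    | zero => simp [K]
    | succ n ih =>
      rw [K_succ, ← Submodule.inf_orthogonal, Submodule.mem_inf,
        Submodule.mem_orthogonal_singleton_iff_inner_right]
      exact ⟨ih fun m hm => hy m (hm.trans n.lt_succ_self), hy n n.lt_succ_self⟩
  refine ⟨fun n => v (K n), fun n => r (K n), ⟨fun n => norm_v _, fun m n hmn => ?_⟩,
    fun n => r_nonneg _, fun n => T_v _, fun n y hy => T_le _ y (mem_K_orthogonal n hy)⟩
  rcases hmn.lt_or_gt with h | h
  exacts [inner_eq_zero h, inner_eq_zero_symm.1 (inner_eq_zero h)]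

end CompactPositiveOperators

section EigenvalueSequence

variable {H : Type*} [NormedAddCommGroup H] [InnerProductSpace ℂ H]

theorem IsEigenvalueSequence.nonneg {T : H →L[ℂ] H} {s : ℕ → ℝ} (hs : IsEigenvalueSequence T s)
    (n : ℕ) : 0 ≤ s n :=
  hs.antitone.le_of_tendsto hs.tendsto_zero n

theorem IsEigenvalueSequence.exists_orthonormal_eigenvectors {T : H →L[ℂ] H} {s : ℕ → ℝ}
    (hs : IsEigenvalueSequence T s) :
    ∃ e : ℕ → H, Orthonormal ℂ e ∧ (∀ n, T (e n) = (s n : ℂ) • e n) ∧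
      ∀ x, (∀ n, inner ℂ (e n) x = 0) → T x = 0 := by
  obtain ⟨e, he, hTe⟩ := hs.decomposition
  refine ⟨e, he, fun n => (hTe (e n)).unique ?_, fun x hx => ?_⟩
  · convert hasSum_single n fun k hk => ?_ using 1
    · simp [inner_self_eq_norm_sq_to_K, he.1 n]
    · simp [he.2 hk]
  · simpa [hx] using (hTe x).tsum_eq.symm

/- The trace pairing `∑ j ∈ F, ⟪e j, A T (e j)⟫` equals `∑ k, s k * d k`, where `d k` is at most
`‖A‖` and the total mass of `d` is at most `#F * ‖A‖`, so the mass is best placed on the first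
`#F` indices. -/
theorem IsEigenvalueSequence.norm_sum_inner_le [CompleteSpace H] {T : H →L[ℂ] H} {s : ℕ → ℝ}
    (hs : IsEigenvalueSequence T s) (A : H →L[ℂ] H) {ι : Type*} {e : ι → H}
    (he : Orthonormal ℂ e) (F : Finset ι) :
    ‖∑ j ∈ F, inner ℂ (e j) (A (T (e j)))‖ ≤ ‖A‖ * ∑ k ∈ Finset.range F.card, s k := by
  obtain ⟨u, hu, hTu⟩ := hs.decomposition
  have expansion : HasSum (fun k => ∑ j ∈ F, s k * inner ℂ (u k) (e j) * inner ℂ (e j) (A (u k)))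
      (∑ j ∈ F, inner ℂ (e j) (A (T (e j)))) :=
    hasSum_sum fun j _ => by
      simpa [inner_smul_right, mul_assoc] using ((hTu (e j)).mapL A).mapL (innerSL ℂ (e j))
  let d (k : ℕ) : ℝ := ∑ j ∈ F, ‖inner ℂ (e j) (u k)‖ * ‖inner ℂ (e j) (A (u k))‖
  have d_le (k : ℕ) : d k ≤ ‖A‖ := (sum_norm_inner_mul_norm_inner_le he _ _ F).trans <| by
    simpa [hu.1 k] using A.le_opNorm (u k)
  have sum_d_le (N : ℕ) : ∑ k ∈ Finset.range N, d k ≤ F.card * ‖A‖ := by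
    rw [Finset.sum_comm, ← nsmul_eq_mul]
    refine Finset.sum_le_card_nsmul F _ _ fun j _ => ?_
    have adjoint_eq (k : ℕ) : ‖inner ℂ (e j) (A (u k))‖ =
        ‖inner ℂ (u k) (ContinuousLinearMap.adjoint A (e j))‖ := by
      rw [norm_inner_symm, ContinuousLinearMap.adjoint_inner_right]
    simp only [norm_inner_symm (e j) (u _), adjoint_eq]
    refine (sum_norm_inner_mul_norm_inner_le hu _ _ _).trans ?_
    simpa [he.1 j] using (ContinuousLinearMap.adjoint A).le_opNorm (e j)
  refine le_of_tendsto expansion.tendsto_sum_nat.norm ?_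
  filter_upwards [Filter.eventually_ge_atTop F.card] with N hN
  calc _ ≤ ∑ k ∈ Finset.range N, s k * d k := by
        refine (norm_sum_le _ _).trans (Finset.sum_le_sum fun k _ => ?_)
        refine (norm_sum_le _ _).trans_eq ?_
        simp only [d, Finset.mul_sum, norm_mul, Complex.norm_real,
          Real.norm_of_nonneg (hs.nonneg k), norm_inner_symm (u k), mul_assoc]
    _ ≤ ‖A‖ * ∑ k ∈ Finset.range F.card, s k :=
        sum_range_mul_le_mul_sum_range_of_antitone hs.antitone (hs.nonneg _)
          (fun k => by positivity) d_le hN (sum_d_le N)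

theorem IsEigenvalueSequence.exists_orthonormal_sum_inner_eq {T : H →L[ℂ] H} {s : ℕ → ℝ}
    (hs : IsEigenvalueSequence T s) :
    ∃ e : ℕ → H, Orthonormal ℂ e ∧
      ∀ F : Finset ℕ, ∑ j ∈ F, inner ℂ (e j) (T (e j)) = (∑ k ∈ F, s k : ℝ) := by
  obtain ⟨e, he, hTe, -⟩ := hs.exists_orthonormal_eigenvectors
  refine ⟨e, he, fun F => ?_⟩
  simp [hTe, inner_self_eq_norm_sq_to_K, he.1]

variable [CompleteSpace H]

theorem IsEigenvalueSequence.sum_range_le {T : H →L[ℂ] H} {s t : ℕ → ℝ}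
    (hs : IsEigenvalueSequence T s) (ht : IsEigenvalueSequence T t) (n : ℕ) :
    ∑ k ∈ Finset.range n, s k ≤ ∑ k ∈ Finset.range n, t k := by
  obtain ⟨e, he, sum_inner_eq⟩ := hs.exists_orthonormal_sum_inner_eq
  have ky_fan := ht.norm_sum_inner_le 1 he (Finset.range n)
  simp only [one_apply_eq_self, sum_inner_eq, Complex.norm_real, Finset.card_range] at ky_fan
  exact (Real.le_norm_self _).trans <| ky_fan.trans <| mul_le_of_le_one_left
    (Finset.sum_nonneg fun k _ => ht.nonneg k) ContinuousLinearMap.norm_id_le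

theorem IsEigenvalueSequence.unique {T : H →L[ℂ] H} {s t : ℕ → ℝ}
    (hs : IsEigenvalueSequence T s) (ht : IsEigenvalueSequence T t) : s = t := by
  have sum_eq (n : ℕ) : ∑ k ∈ Finset.range n, s k = ∑ k ∈ Finset.range n, t k :=
    (hs.sum_range_le ht n).antisymm (ht.sum_range_le hs n)
  ext n
  rw [← Finset.sum_range_succ_sub_sum s, ← Finset.sum_range_succ_sub_sum t, sum_eq, sum_eq]

theorem IsEigenvalueSequence.eigenvalueSequence_eq {T : H →L[ℂ] H} {s : ℕ → ℝ}
    (hs : IsEigenvalueSequence T s) : eigenvalueSequence T = s := by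
  have h : ∃ s, IsEigenvalueSequence T s := ⟨s, hs⟩
  rw [eigenvalueSequence, dif_pos h]
  exact h.choose_spec.unique hs

theorem norm_abs_apply (a : H →L[ℂ] H) (x : H) : ‖CFC.abs a x‖ = ‖a x‖ := by
  have adjoint_abs : ContinuousLinearMap.adjoint (CFC.abs a) = CFC.abs a :=
    (IsSelfAdjoint.of_nonneg (CFC.abs_nonneg a)).star_eq
  have comp_eq : ContinuousLinearMap.adjoint (CFC.abs a) ∘L CFC.abs a =
      ContinuousLinearMap.adjoint a ∘L a := by
    rw [adjoint_abs]
    exact CFC.abs_mul_abs a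
  rw [← sq_eq_sq₀ (norm_nonneg _) (norm_nonneg _),
    ContinuousLinearMap.apply_norm_sq_eq_inner_adjoint_left, comp_eq,
    ← ContinuousLinearMap.apply_norm_sq_eq_inner_adjoint_left]

theorem exists_contraction_comp_abs_eq (a : H →L[ℂ] H) :
    ∃ U : H →L[ℂ] H, ‖U‖ ≤ 1 ∧ U ∘L CFC.abs a = a :=
  exists_comp_eq_of_norm_apply_le zero_le_one fun x => by rw [norm_abs_apply, one_mul]

theorem exists_contraction_comp_eq_abs (a : H →L[ℂ] H) :
    ∃ U : H →L[ℂ] H, ‖U‖ ≤ 1 ∧ U ∘L a = CFC.abs a :=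
  exists_comp_eq_of_norm_apply_le zero_le_one fun x => by rw [norm_abs_apply, one_mul]

theorem IsEigenvalueSequence.norm_sum_inner_le_of_abs {a : H →L[ℂ] H} {s : ℕ → ℝ}
    (hs : IsEigenvalueSequence (CFC.abs a) s) {W : H →L[ℂ] H} (hW : ‖W‖ ≤ 1) {ι : Type*}
    {e : ι → H} (he : Orthonormal ℂ e) (F : Finset ι) :
    ‖∑ j ∈ F, inner ℂ (e j) (W (a (e j)))‖ ≤ ∑ k ∈ Finset.range F.card, s k := by
  obtain ⟨U, hU, hUa⟩ := exists_contraction_comp_abs_eq a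
  have comp_le_one : ‖W ∘L U‖ ≤ 1 :=
    (W.opNorm_comp_le U).trans (mul_le_one₀ hW (norm_nonneg U) hU)
  nth_rw 1 [← hUa]
  exact (hs.norm_sum_inner_le (W ∘L U) he F).trans <|
    mul_le_of_le_one_left (Finset.sum_nonneg fun k _ => hs.nonneg k) comp_le_one

theorem sum_range_eigenvalues_abs_add_le {a b : H →L[ℂ] H} {s t w : ℕ → ℝ}
    (hs : IsEigenvalueSequence (CFC.abs a) s) (ht : IsEigenvalueSequence (CFC.abs b) t)
    (hw : IsEigenvalueSequence (CFC.abs (a + b)) w) (n : ℕ) :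
    ∑ k ∈ Finset.range n, w k ≤ ∑ k ∈ Finset.range n, (s k + t k) := by
  obtain ⟨W, hW, hWab⟩ := exists_contraction_comp_eq_abs (a + b)
  obtain ⟨e, he, sum_inner_eq⟩ := hw.exists_orthonormal_sum_inner_eq
  have split : (∑ k ∈ Finset.range n, w k : ℝ) =
      ∑ j ∈ Finset.range n, inner ℂ (e j) (W (a (e j))) +
        ∑ j ∈ Finset.range n, inner ℂ (e j) (W (b (e j))) := by
    rw [← sum_inner_eq, ← hWab, ← Finset.sum_add_distrib]
    simp
  calc ∑ k ∈ Finset.range n, w k ≤ ‖((∑ k ∈ Finset.range n, w k : ℝ) : ℂ)‖ := by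
        rw [Complex.norm_real]
        exact Real.le_norm_self _
    _ ≤ ∑ k ∈ Finset.range n, s k + ∑ k ∈ Finset.range n, t k := by
        rw [split]
        simpa only [Finset.card_range] using (norm_add_le _ _).trans (add_le_add
          (hs.norm_sum_inner_le_of_abs hW he (Finset.range n))
          (ht.norm_sum_inner_le_of_abs hW he (Finset.range n)))
    _ = ∑ k ∈ Finset.range n, (s k + t k) := Finset.sum_add_distrib.symm

end EigenvalueSequence

section CompactOperators

variable {H : Type*} [NormedAddCommGroup H] [InnerProductSpace ℂ H] [CompleteSpace H]

theorem exists_isEigenvalueSequence (hH : ¬ FiniteDimensional ℂ H) {T : H →L[ℂ] H} (hT : 0 ≤ T)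
    (hc : IsCompactOperator T) : ∃ s, IsEigenvalueSequence T s := by
  obtain ⟨e, s, he, hs0, hTe, T_le⟩ := exists_orthonormal_greedy_eigenvectors hH hT hc
  have antitone : Antitone s := antitone_nat_of_succ_le fun n => by
    simpa [hTe, norm_smul, he.1, abs_of_nonneg, hs0] using
      T_le n (e (n + 1)) fun m hm => he.2 (by omega)
  have tendsto_zero : Filter.Tendsto s Filter.atTop (nhds 0) := by
    simpa [hTe, norm_smul, he.1, abs_of_nonneg, hs0, Nat.cofinite_eq_atTop] using
      (tendsto_apply_cofinite_of_orthonormal hc he).norm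
  have apply_eq_zero (x : H) (hx : ∀ n, inner ℂ (e n) x = 0) : T x = 0 := by
    have bound_tendsto := tendsto_zero.mul_const ‖x‖
    rw [zero_mul] at bound_tendsto
    exact norm_le_zero_iff.1 (ge_of_tendsto' bound_tendsto fun n => T_le n x fun m _ => hx m)
  refine ⟨s, antitone, tendsto_zero, e, he, fun x => ?_⟩
  simpa only [hTe, smul_comm (inner ℂ _ x)] using hasSum_inner_smul_apply he apply_eq_zero x

theorem mem_spectrum_real_of_apply_eq_smul {T : H →L[ℂ] H} {x : H} (hx0 : x ≠ 0) {r : ℝ}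
    (hx : T x = (r : ℂ) • x) : r ∈ spectrum ℝ T := by
  rw [spectrum.mem_iff, ContinuousLinearMap.isUnit_iff_bijective]
  exact fun bijective => hx0 <| bijective.injective <| by
    simp [Algebra.algebraMap_eq_smul_one, hx]

theorem cfc_apply_of_apply_eq_smul {T : H →L[ℂ] H} (hT : IsSelfAdjoint T) {x : H} {r : ℝ}
    (hx : T x = (r : ℂ) • x) {f : ℝ → ℝ} (hf : ContinuousOn f (spectrum ℝ T)) :
    cfc f T x = (f r : ℂ) • x := by
  rcases eq_or_ne x 0 with rfl | hx0
  · simp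
  have hr : r ∈ spectrum ℝ T := mem_spectrum_real_of_apply_eq_smul hx0 hx
  suffices h : ∀ g : C(spectrum ℝ T, ℝ), cfcHom hT g x = (g ⟨r, hr⟩ : ℂ) • x by
    rw [cfc_apply f T hT hf, h]
    rfl
  intro g
  have apply_id : cfcHom hT (.restrict (spectrum ℝ T) (.id ℝ)) x = (r : ℂ) • x := by
    rw [cfcHom_id hT, hx]
  induction g using ContinuousMap.induction_on_of_compact with
  | const c =>
    change cfcHom hT (algebraMap ℝ C(spectrum ℝ T, ℝ) c) x = _
    rw [AlgHomClass.commutes]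
    simp [Algebra.algebraMap_eq_smul_one]
  | id => exact apply_id
  | star_id => simpa using apply_id
  | add f g hf hg => simp [hf, hg, add_smul]
  | mul f g hf hg => simp [hf, hg, smul_smul, -Complex.coe_smul, mul_comm]
  | frequently f h =>
    have closed : IsClosed {g : C(spectrum ℝ T, ℝ) | cfcHom hT g x = (g ⟨r, hr⟩ : ℂ) • x} :=
      isClosed_eq ((ContinuousLinearMap.apply ℂ H x).continuous.comp (cfcHom_continuous hT))
        (by fun_prop)
    exact closed.mem_of_frequently_of_tendsto h Filter.tendsto_id

theorem IsEigenvalueSequence.map_cfc {T : H →L[ℂ] H} (hT : IsSelfAdjoint T) {s : ℕ → ℝ}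
    (hs : IsEigenvalueSequence T s) {f : ℝ → ℝ} (hf : Continuous f)
    (hf_mono : MonotoneOn f (Set.Ici 0)) (hf0 : f 0 = 0) :
    IsEigenvalueSequence (cfc f T) (f ∘ s) where
  antitone m n hmn := hf_mono (hs.nonneg n) (hs.nonneg m) (hs.antitone hmn)
  tendsto_zero := by
    simpa only [hf0] using (hf.tendsto 0).comp hs.tendsto_zero
  decomposition := by
    obtain ⟨e, he, hTe, apply_eq_zero⟩ := hs.exists_orthonormal_eigenvectors
    refine ⟨e, he, fun x => ?_⟩
    have cfc_apply_eq_zero (y : H) (hy : ∀ n, inner ℂ (e n) y = 0) : cfc f T y = 0 := by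
      simpa [hf0] using cfc_apply_of_apply_eq_smul (r := 0) hT
        (by simp [apply_eq_zero y hy]) hf.continuousOn
    have apply_eigenvector (n : ℕ) : cfc f T (e n) = (f (s n) : ℂ) • e n :=
      cfc_apply_of_apply_eq_smul hT (hTe n) hf.continuousOn
    simpa only [apply_eigenvector, Function.comp_apply, smul_comm (inner ℂ _ x)] using
      hasSum_inner_smul_apply he cfc_apply_eq_zero x

theorem IsEigenvalueSequence.rpow {T : H →L[ℂ] H} (hT : 0 ≤ T) {s : ℕ → ℝ}
    (hs : IsEigenvalueSequence T s) {q : ℝ} (hq : 0 < q) :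
    IsEigenvalueSequence (T ^ q) fun n => s n ^ q := by
  rw [CFC.rpow_eq_cfc_real hT]
  exact hs.map_cfc (.of_nonneg hT) (Real.continuous_rpow_const hq.le)
    (Real.monotoneOn_rpow_Ici_of_exponent_nonneg hq.le) (Real.zero_rpow hq.ne')

theorem exists_isEigenvalueSequence_abs (hH : ¬ FiniteDimensional ℂ H) {a : H →L[ℂ] H}
    (ha : IsCompactOperator a) : ∃ s, IsEigenvalueSequence (CFC.abs a) s := by
  have nonneg : 0 ≤ star a * a := star_mul_self_nonneg a
  obtain ⟨t, ht⟩ := exists_isEigenvalueSequence hH nonneg (ha.clm_comp (star a))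
  rw [CFC.abs, CFC.sqrt_eq_rpow]
  exact ⟨_, ht.rpow nonneg (by norm_num)⟩

end CompactOperators

section ChoquetSchattenNorm

variable {H : Type*} [NormedAddCommGroup H] [InnerProductSpace ℂ H] [CompleteSpace H]
  {α : ℕ → ℝ} {p : ℝ}

theorem choquetSchattenNorm_eq_weightedLpNorm (hα : Monotone α) (hα0 : α 0 = 0) (hp : 0 < p)
    {a : H →L[ℂ] H} {s : ℕ → ℝ} (hs : IsEigenvalueSequence (CFC.abs a) s) :
    choquetSchattenNorm α p a =
      weightedLpNorm (fun k => .ofReal (α (k + 1) - α k)) p fun k => .ofReal (s k) := by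
  have hsp := hs.rpow (CFC.abs_nonneg a) hp
  rw [choquetSchattenNorm, choquetTrace, hsp.eigenvalueSequence_eq,
    tsum_ofReal_sub_mul_eq hα hα0 hsp.antitone hsp.tendsto_zero, weightedLpNorm]
  simp only [ENNReal.ofReal_rpow_of_nonneg (hs.nonneg _) hp.le]

theorem choquetSchattenNorm_add_le (hH : ¬ FiniteDimensional ℂ H) (hα : Monotone α)
    (hα0 : α 0 = 0) (hp : 1 ≤ p) (hc : Antitone fun k => α (k + 1) - α k) {a b : H →L[ℂ] H}
    (ha : IsCompactOperator a) (hb : IsCompactOperator b) :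
    choquetSchattenNorm α p (a + b) ≤ choquetSchattenNorm α p a + choquetSchattenNorm α p b := by
  obtain ⟨s, hs⟩ := exists_isEigenvalueSequence_abs hH ha
  obtain ⟨t, ht⟩ := exists_isEigenvalueSequence_abs hH hb
  obtain ⟨w, hw⟩ := exists_isEigenvalueSequence_abs (a := a + b) hH (ha.add hb)
  have hp0 : 0 < p := by linarith
  rw [choquetSchattenNorm_eq_weightedLpNorm hα hα0 hp0 hs,
    choquetSchattenNorm_eq_weightedLpNorm hα hα0 hp0 ht,
    choquetSchattenNorm_eq_weightedLpNorm hα hα0 hp0 hw]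
  calc _ ≤ weightedLpNorm (fun k => .ofReal (α (k + 1) - α k)) p fun k => .ofReal (s k + t k) :=
        weightedLpNorm_le_of_sum_range_le hp hc (fun k => sub_nonneg.2 (hα k.le_succ)) hw.antitone
          hw.nonneg (fun k => add_nonneg (hs.nonneg k) (ht.nonneg k))
          (sum_range_eigenvalues_abs_add_le hs ht hw)
    _ ≤ _ := by
        simp only [ENNReal.ofReal_add (hs.nonneg _) (ht.nonneg _)]
        exact weightedLpNorm_add_le _ hp _ _

end ChoquetSchattenNorm

section DiagonalOperator

theorem exists_orthonormal_nat_of_not_finiteDimensional {𝕜 E : Type*} [RCLike 𝕜]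
    [NormedAddCommGroup E] [InnerProductSpace 𝕜 E] [CompleteSpace E]
    (hE : ¬ FiniteDimensional 𝕜 E) : ∃ e : ℕ → E, Orthonormal 𝕜 e := by
  obtain ⟨w, b, -⟩ := exists_hilbertBasis 𝕜 E
  have : Infinite w := not_finite_iff_infinite.1 fun _ =>
    have := Fintype.ofFinite w
    hE b.toOrthonormalBasis.toBasis.finiteDimensional_of_finite
  exact ⟨b ∘ Infinite.natEmbedding w, b.orthonormal.comp _ (Infinite.natEmbedding w).injective⟩

theorem isCompactOperator_rankOne {𝕜 E F : Type*} [RCLike 𝕜] [NormedAddCommGroup E]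
    [InnerProductSpace 𝕜 E] [NormedAddCommGroup F] [NormedSpace 𝕜 F] (x : F) (y : E) :
    IsCompactOperator (InnerProductSpace.rankOne 𝕜 x y) := by
  rw [InnerProductSpace.rankOne_def']
  exact ((isCompactOperator_id (E := 𝕜)).clm_comp (.toSpanSingleton 𝕜 x)).comp_clm (innerSL 𝕜 y)

variable {ι H : Type*} [NormedAddCommGroup H] [InnerProductSpace ℂ H]

/-- The finite rank operator `∑_{k ∈ F} x_k e_k ⊗ e_k`, which is diagonal with entries `x_k` when
`e` is orthonormal. -/
noncomputable def diagonalOperator (e : ι → H) (F : Finset ι) (x : ι → ℝ) : H →L[ℂ] H :=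
  ∑ k ∈ F, (x k : ℂ) • InnerProductSpace.rankOne ℂ (e k) (e k)

theorem diagonalOperator_add (e : ι → H) (F : Finset ι) (x y : ι → ℝ) :
    diagonalOperator e F (x + y) = diagonalOperator e F x + diagonalOperator e F y := by
  simp only [diagonalOperator, Pi.add_apply, Complex.ofReal_add, add_smul, Finset.sum_add_distrib]

theorem diagonalOperator_comp_perm (e : ι → H) {F : Finset ι} {σ : Equiv.Perm ι}
    (hσ : {k | σ k ≠ k} ⊆ F) (x : ι → ℝ) :
    diagonalOperator (e ∘ σ) F (x ∘ σ) = diagonalOperator e F x :=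
  Equiv.Perm.sum_comp σ F (fun k => (x k : ℂ) • InnerProductSpace.rankOne ℂ (e k) (e k)) hσ

theorem diagonalOperator_nonneg (e : ι → H) (F : Finset ι) {x : ι → ℝ} (hx : ∀ k, 0 ≤ x k) :
    0 ≤ diagonalOperator e F x := by
  rw [ContinuousLinearMap.nonneg_iff_isPositive]
  exact ContinuousLinearMap.isPositive_sum _ fun k _ =>
    (InnerProductSpace.isPositive_rankOne_self (e k)).smul_of_nonneg (by exact_mod_cast hx k)

theorem isCompactOperator_diagonalOperator (e : ι → H) (F : Finset ι) (x : ι → ℝ) :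
    IsCompactOperator (diagonalOperator e F x) :=
  Submodule.sum_mem (compactOperator (.id ℂ) H H) fun k _ =>
    (isCompactOperator_rankOne (e k) (e k)).smul (x k : ℂ)

theorem isEigenvalueSequence_diagonalOperator {e : ℕ → H} (he : Orthonormal ℂ e) {F : Finset ℕ}
    {x : ℕ → ℝ} (hx : Antitone x) (hxF : ∀ k ∉ F, x k = 0) :
    IsEigenvalueSequence (diagonalOperator e F x) x where
  antitone := hx
  tendsto_zero := tendsto_const_nhds.congr' <| by
    rw [← Nat.cofinite_eq_atTop]
    filter_upwards [F.finite_toSet.compl_mem_cofinite] with k hk using (hxF k hk).symm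
  decomposition := ⟨e, he, fun y => by
    simp only [diagonalOperator, sum_apply, smul_apply,
      InnerProductSpace.rankOne_apply]
    exact hasSum_sum_of_ne_finset_zero fun k hk => by simp [hxF k hk]⟩

theorem choquetSchattenNorm_diagonalOperator [CompleteSpace H] {α : ℕ → ℝ} (hα : Monotone α)
    (hα0 : α 0 = 0) {p : ℝ} (hp : 0 < p) {e : ℕ → H} (he : Orthonormal ℂ e) {F : Finset ℕ}
    {x : ℕ → ℝ} (hx : Antitone x) (hx0 : ∀ k, 0 ≤ x k) (hxF : ∀ k ∉ F, x k = 0) :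
    choquetSchattenNorm α p (diagonalOperator e F x) =
      ENNReal.ofReal (∑ k ∈ F, (α (k + 1) - α k) * x k ^ p) ^ (1 / p) := by
  have eigenvalues : IsEigenvalueSequence (CFC.abs (diagonalOperator e F x)) x := by
    rw [CFC.abs_of_nonneg _ (diagonalOperator_nonneg e F hx0)]
    exact isEigenvalueSequence_diagonalOperator he hx hxF
  have c_nonneg (k : ℕ) : 0 ≤ α (k + 1) - α k := sub_nonneg.2 (hα k.le_succ)
  rw [choquetSchattenNorm_eq_weightedLpNorm hα hα0 hp eigenvalues, weightedLpNorm,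
    tsum_eq_sum (s := F) fun k hk => by simp [hxF k hk, hp],
    ENNReal.ofReal_sum_of_nonneg fun k _ => mul_nonneg (c_nonneg k) (Real.rpow_nonneg (hx0 k) p)]
  simp only [ENNReal.ofReal_rpow_of_nonneg (hx0 _) hp.le, ENNReal.ofReal_mul (c_nonneg _)]

end DiagonalOperator

section StepSequence

/-- The sequence `(t, …, t, u, v, 0, 0, …)` starting with `m` entries equal to `t`. -/
def stepSequence {R : Type*} [Zero R] (m : ℕ) (t u v : R) (k : ℕ) : R :=
  if k < m then t else if k = m then u else if k = m + 1 then v else 0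

theorem stepSequence_eq_zero {R : Type*} [Zero R] {m k : ℕ} (t u v : R)
    (hk : k ∉ Finset.range (m + 2)) : stepSequence m t u v k = 0 := by
  grind [stepSequence]

theorem stepSequence_antitone {R : Type*} [Zero R] [Preorder R] (m : ℕ) {t u v : R} (hut : u ≤ t)
    (hvu : v ≤ u) (hv : 0 ≤ v) : Antitone (stepSequence m t u v) :=
  antitone_nat_of_succ_le fun k => by
    unfold stepSequence
    split_ifs <;> first | omega | simp only [le_refl, *]

theorem stepSequence_nonneg {R : Type*} [Zero R] [Preorder R] (m : ℕ) {t u v : R} (ht : 0 ≤ t)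
    (hu : 0 ≤ u) (hv : 0 ≤ v) (k : ℕ) : 0 ≤ stepSequence m t u v k := by
  unfold stepSequence
  split_ifs <;> first | assumption | rfl

theorem stepSequence_add_comp_swap {R : Type*} [AddCommMonoid R] (m : ℕ) (t u v : R) :
    stepSequence m t u v + stepSequence m t u v ∘ Equiv.swap m (m + 1) =
      stepSequence m (t + t) (u + v) (u + v) := by
  funext k
  simp only [Pi.add_apply, Function.comp_apply]
  grind [stepSequence]

theorem sum_range_stepSequence {R M : Type*} [Zero R] [AddCommMonoid M] (f : ℕ → R → M) (m : ℕ)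
    (t u v : R) : ∑ k ∈ Finset.range (m + 2), f k (stepSequence m t u v k) =
      ∑ k ∈ Finset.range m, f k t + f m u + f (m + 1) v := by
  rw [Finset.sum_range_succ, Finset.sum_range_succ,
    Finset.sum_congr rfl fun k hk => by rw [stepSequence, if_pos (Finset.mem_range.1 hk)]]
  simp [stepSequence]

theorem diagonalOperator_stepSequence_add_comp_swap {H : Type*} [NormedAddCommGroup H]
    [InnerProductSpace ℂ H] (e : ℕ → H) (m : ℕ) (t u v : ℝ) :
    diagonalOperator e (Finset.range (m + 2)) (stepSequence m t u v) +
        diagonalOperator (e ∘ Equiv.swap m (m + 1)) (Finset.range (m + 2)) (stepSequence m t u v) =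
      diagonalOperator e (Finset.range (m + 2)) (stepSequence m (t + t) (u + v) (u + v)) := by
  have swap_support : {k | Equiv.swap m (m + 1) k ≠ k} ⊆ Finset.range (m + 2) := fun k hk => by
    grind [Equiv.swap_apply_of_ne_of_ne]
  rw [← stepSequence_add_comp_swap, diagonalOperator_add,
    ← diagonalOperator_comp_perm e swap_support (stepSequence m t u v ∘ Equiv.swap m (m + 1)),
    Function.comp_assoc, ← Equiv.coe_trans, Equiv.swap_swap, Equiv.coe_refl, Function.comp_id]

end StepSequence

section Converse

theorem le_of_forall_midpoint_rpow_le {p c d : ℝ} (hp : 0 < p)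
    (h : ∀ r ∈ Set.Icc (0 : ℝ) 1, (c + d) * ((1 + r) / 2) ^ p ≤ c + d * r ^ p) : d ≤ c := by
  let g (r : ℝ) : ℝ := c + d * r ^ p - (c + d) * ((1 + r) / 2) ^ p
  have g_deriv : HasDerivAt g (p * (d - c) / 2) 1 := by
    have rpow_deriv : HasDerivAt (fun r : ℝ => r ^ p) (p * 1 ^ (p - 1)) 1 :=
      Real.hasDerivAt_rpow_const (.inl one_ne_zero)
    have midpoint_rpow_deriv :=
      (((hasDerivAt_id (1 : ℝ)).const_add 1).div_const 2).rpow_const (p := p) (.inl (by norm_num))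
    refine (((rpow_deriv.const_mul d).const_add c).sub
      (midpoint_rpow_deriv.const_mul (c + d))).congr_deriv ?_
    norm_num
    ring
  have g_min : IsMinOn g (Set.Icc 0 1) 1 := fun r hr => by simpa [g] using h r hr
  have inward : (-1 : ℝ) ∈ posTangentConeAt (Set.Icc 0 1) (1 : ℝ) :=
    mem_posTangentConeAt_of_segment_subset (by simp [segment_eq_uIcc])
  have inward_deriv_nonneg : 0 ≤ -(p * (d - c) / 2) := by
    simpa using
      g_min.localize.hasFDerivWithinAt_nonneg g_deriv.hasFDerivAt.hasFDerivWithinAt inward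
  exact le_of_mul_le_mul_left (by linarith) hp

theorem ofReal_rpow_one_div_le_add_self_iff {p S T : ℝ} (hp : 0 < p) (hT : 0 ≤ T) :
    ENNReal.ofReal S ^ (1 / p) ≤ ENNReal.ofReal T ^ (1 / p) + ENNReal.ofReal T ^ (1 / p) ↔
      S ≤ 2 ^ p * T := by
  have two_rpow : (2 : ℝ≥0∞) ^ p = ENNReal.ofReal (2 ^ p) := by
    rw [← ENNReal.ofReal_rpow_of_pos two_pos, ENNReal.ofReal_ofNat]
  rw [← two_mul, one_div, ENNReal.rpow_inv_le_iff hp, ENNReal.mul_rpow_of_nonneg _ _ hp.le,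
    ENNReal.rpow_inv_rpow hp.ne', two_rpow, ← ENNReal.ofReal_mul (by positivity),
    ENNReal.ofReal_le_ofReal_iff (by positivity)]

variable {H : Type*} [NormedAddCommGroup H] [InnerProductSpace ℂ H] [CompleteSpace H]
  {α : ℕ → ℝ} {p : ℝ}

theorem choquetSchattenNorm_diagonalOperator_stepSequence (hα : Monotone α) (hα0 : α 0 = 0)
    (hp : 0 < p) {e : ℕ → H} (he : Orthonormal ℂ e) (m : ℕ) {t u v : ℝ} (hut : u ≤ t)
    (hvu : v ≤ u) (hv : 0 ≤ v) :
    choquetSchattenNorm α p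
        (diagonalOperator e (Finset.range (m + 2)) (stepSequence m t u v)) =
      ENNReal.ofReal (α m * t ^ p + (α (m + 1) - α m) * u ^ p +
        (α (m + 2) - α (m + 1)) * v ^ p) ^ (1 / p) := by
  have hu : 0 ≤ u := hv.trans hvu
  rw [choquetSchattenNorm_diagonalOperator hα hα0 hp he (stepSequence_antitone m hut hvu hv)
      (stepSequence_nonneg m (hu.trans hut) hu hv) (fun k => stepSequence_eq_zero t u v),
    sum_range_stepSequence fun k x => (α (k + 1) - α k) * x ^ p, ← Finset.sum_mul,
    Finset.sum_range_sub, hα0, sub_zero]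

theorem midpoint_rpow_le_of_choquetSchattenNorm_add_le (hH : ¬ FiniteDimensional ℂ H)
    (hα : Monotone α) (hα0 : α 0 = 0) (hp : 0 < p)
    (h : ∀ a b : H →L[ℂ] H, IsCompactOperator a → IsCompactOperator b →
      choquetSchattenNorm α p (a + b) ≤ choquetSchattenNorm α p a + choquetSchattenNorm α p b)
    (m : ℕ) {r : ℝ} (hr : r ∈ Set.Icc (0 : ℝ) 1) :
    (α (m + 1) - α m + (α (m + 2) - α (m + 1))) * ((1 + r) / 2) ^ p ≤
      α (m + 1) - α m + (α (m + 2) - α (m + 1)) * r ^ p := by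
  obtain ⟨e, he⟩ := exists_orthonormal_nat_of_not_finiteDimensional hH
  have triangle := h _ _
    (isCompactOperator_diagonalOperator e (Finset.range (m + 2)) (stepSequence m 1 1 r))
    (isCompactOperator_diagonalOperator (e ∘ Equiv.swap m (m + 1)) (Finset.range (m + 2))
      (stepSequence m 1 1 r))
  have c_nonneg (k : ℕ) : 0 ≤ α (k + 1) - α k := sub_nonneg.2 (hα k.le_succ)
  have norm_pow_nonneg : 0 ≤ α m * 1 ^ p + (α (m + 1) - α m) * 1 ^ p +
      (α (m + 2) - α (m + 1)) * r ^ p :=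
    add_nonneg (add_nonneg (mul_nonneg (hα0 ▸ hα m.zero_le) (by simp))
      (mul_nonneg (c_nonneg m) (by simp)))
      (mul_nonneg (c_nonneg (m + 1)) (Real.rpow_nonneg hr.1 p))
  rw [diagonalOperator_stepSequence_add_comp_swap,
    choquetSchattenNorm_diagonalOperator_stepSequence hα hα0 hp he m le_rfl hr.2 hr.1,
    choquetSchattenNorm_diagonalOperator_stepSequence hα hα0 hp (he.comp _ (Equiv.injective _)) m
      le_rfl hr.2 hr.1,
    choquetSchattenNorm_diagonalOperator_stepSequence hα hα0 hp he m (by linarith [hr.2]) le_rfl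
      (by linarith [hr.1]), ofReal_rpow_one_div_le_add_self_iff hp norm_pow_nonneg,
    one_add_one_eq_two] at triangle
  rw [Real.div_rpow (by linarith [hr.1]) two_pos.le, ← mul_div_assoc, div_le_iff₀ (by positivity)]
  simp only [Real.one_rpow] at triangle
  linarith

theorem antitone_of_choquetSchattenNorm_add_le (hH : ¬ FiniteDimensional ℂ H)
    (hα : Monotone α) (hα0 : α 0 = 0) (hp : 0 < p)
    (h : ∀ a b : H →L[ℂ] H, IsCompactOperator a → IsCompactOperator b →
      choquetSchattenNorm α p (a + b) ≤ choquetSchattenNorm α p a + choquetSchattenNorm α p b) :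
    Antitone fun k => α (k + 1) - α k :=
  antitone_nat_of_succ_le fun m => le_of_forall_midpoint_rpow_le hp fun _ hr =>
    midpoint_rpow_le_of_choquetSchattenNorm_add_le hH hα hα0 hp h m hr

end Converse

section Concave

theorem antitoneOn_Ici_one_iff {G : Type*} [Sub G] [Preorder G] (α : ℕ → G) :
    AntitoneOn (fun i => α i - α (i - 1)) (Set.Ici 1) ↔ Antitone fun k => α (k + 1) - α k := by
  refine ⟨fun h i j hij => ?_, fun h i hi j hj hij => ?_⟩
  · exact h (Set.mem_Ici.2 (Nat.le_add_left 1 i)) (Set.mem_Ici.2 (Nat.le_add_left 1 j)) (by omega)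
  · simpa only [Nat.sub_add_cancel hi, Nat.sub_add_cancel hj] using h (Nat.sub_le_sub_right hij 1)

theorem forall_midpoint_le_iff {K : Type*} [Field K] [LinearOrder K] [IsStrictOrderedRing K]
    (α : ℕ → K) : (∀ i, 1 ≤ i → (α (i + 1) + α (i - 1)) / 2 ≤ α i) ↔
      Antitone fun k => α (k + 1) - α k := by
  have midpoint_le_iff (k : ℕ) : (α (k + 1 + 1) + α k) / 2 ≤ α (k + 1) ↔
      α (k + 1 + 1) - α (k + 1) ≤ α (k + 1) - α k := by
    constructor <;> intro h <;> linarith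
  refine ⟨fun h => antitone_nat_of_succ_le fun k => ?_, fun h i hi => ?_⟩
  · exact (midpoint_le_iff k).1 (h (k + 1) (Nat.le_add_left 1 k))
  · obtain ⟨k, rfl⟩ := Nat.exists_eq_add_of_le' hi
    exact (midpoint_le_iff k).2 (h k.le_succ)

end Concave

theorem mainTheorem5_general {H : Type*} [NormedAddCommGroup H] [InnerProductSpace ℂ H]
    [CompleteSpace H] (hH : ¬ FiniteDimensional ℂ H) (p : ℝ) (hp : 1 ≤ p)
    (α : ℕ → ℝ) (hα : Monotone α) (hα0 : α 0 = 0) :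
    List.TFAE
      [∀ i : ℕ, 1 ≤ i → (α (i + 1) + α (i - 1)) / 2 ≤ α i,
       AntitoneOn (fun i : ℕ => α i - α (i - 1)) (Set.Ici 1),
       ∀ a b : H →L[ℂ] H, IsCompactOperator a → IsCompactOperator b →
         choquetSchattenNorm α p (a + b) ≤
           choquetSchattenNorm α p a + choquetSchattenNorm α p b] := by
  rw [forall_midpoint_le_iff, antitoneOn_Ici_one_iff]
  tfae_have 1 ↔ 2 := Iff.rfl
  tfae_have 2 → 3 := fun hc _ _ ha hb => choquetSchattenNorm_add_le hH hα hα0 hp hc ha hb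
  tfae_have 3 → 2 := antitone_of_choquetSchattenNorm_add_le hH hα hα0 (by linarith)
  tfae_finish

theorem mainTheorem5 {H : Type*} [NormedAddCommGroup H] [InnerProductSpace ℂ H] [CompleteSpace H]
    [TopologicalSpace.SeparableSpace H] (hH : ¬ FiniteDimensional ℂ H)
    (p : ℝ) (hp : 1 ≤ p)
    (α : ℕ → ℝ) (hα : Monotone α) (hα0 : α 0 = 0) (hα1 : 0 < α 1) :
    List.TFAE
      [∀ i : ℕ, 1 ≤ i → (α (i + 1) + α (i - 1)) / 2 ≤ α i,
       AntitoneOn (fun i : ℕ => α i - α (i - 1)) (Set.Ici 1),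
       ∀ a b : H →L[ℂ] H, IsCompactOperator a → IsCompactOperator b →
         choquetSchattenNorm α p (a + b) ≤
           choquetSchattenNorm α p a + choquetSchattenNorm α p b] :=
  mainTheorem5_general hH p hp α hα hα0
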